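/- Let $q$ be a prime power, $t\in\{3,4\}$ and $n=2t$. A $q$-polynomial is a polynomial $\sum_{i=0}^{n-1}c_ix^{q^i}$ with coefficients in $\mathbb F_{q^n}$, considered modulo $x^{q^n}-x$, i.e. identified with the map that it induces on $\mathbb F_{q^n}$. For $\rho\in\mathrm{Aut}(\mathbb F_{q^n})$ (a field automorphism) and $f=\sum_i c_ix^{q^i}$ put $f^\rho=\sum_i \rho(c_i)x^{q^i}$. Two sets $\mathcal C,\mathcal C'$ of $q$-polynomials are called equivalent if there are $q$-polynomials $L_1,L_2$ inducing permutations of $\mathbb F_{q^n}$ and $\rho\in\mathrm{Aut}(\mathbb F_{q^n})$ such that $\mathcal C'=\{L_1\circ f^\rho\circ L_2 : f\in\mathcal C\}$. For $h\in\mathbb F_{q^n}$ with $\mathrm N_{q^n/q^t}(h)=h^{q^t+1}=-1$ and a natural number $s$ with $\gcd(s,n)=1$, let $$\psi_{h,t,s}(x)=x^{q^s}+x^{q^{s(t-1)}}+h^{1+q^s}x^{q^{s(t+1)}}+h^{1-q^{s(2t-1)}}x^{q^{s(2t-1)}},\qquad \mathcal C_{h,t,s}=\langle x,\psi_{h,t,s}(x)\rangle_{\mathbb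 F_{q^n}}.$$ Let $h,k\in\mathbb F_{q^n}$ with $h^{q^t+1}=k^{q^t+1}=-1$ and let $s,\ell\in\mathbb N$ with $\gcd(s,n)=\gcd(\ell,n)=1$. (i) If $t=3$, then $\mathcal C_{h,3,s}$ and $\mathcal C_{k,3,\ell}$ are equivalent if and only if one of the following holds: - $s\equiv\ell \pmod 6$ and $\rho(h)\in\{k,-k\}$ for some $\rho\in\mathrm{Aut}(\mathbb F_{q^6})$; - $s\equiv-\ell \pmod 6$ and $\rho(h)\in\{k^{-1},-k^{-1}\}$ for some $\rho\in\mathrm{Aut}(\mathbb F_{q^6})$. (ii) If $t=4$, then $\mathcal C_{h,4,s}$ and $\mathcal C_{k,4,\ell}$ are equivalent if and only if one of the following holds: - $s\equiv\ell \pmod 8$ and $\rho(h)\in\{k,-k\}$ for some $\rho\in\mathrm{Aut}(\mathbb F_{q^8})$; - $s\equiv-\ell \pmod 8$ and $\rho(h)\in\{k^{-1},-k^{-1}\}$ for some $\rho\in\mathrm{Aut}(\mathbb F_{q^8})$; - $s\equiv3\ell \pmod 8$ and $\rho(h)\in\{k,-k\}$ for some $\rho\in\mathrm{Aut}(\mathbb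 F_{q^8})$; - $s\equiv5\ell \pmod 8$ and $\rho(h)\in\{k^{-1},-k^{-1}\}$ for some $\rho\in\mathrm{Aut}(\mathbb F_{q^8})$. -/

import Mathlib

/-- The map `F → F` induced by the `q`-polynomial `∑_{i < n} c i * x ^ (q ^ i)`.  For a field `F` with
`q ^ n` elements, a class of `q`-polynomials modulo `x ^ (q ^ n) - x` is the same thing as the map
it induces, so the algebra of reduced `q`-polynomials is represented by these maps. -/
def qPolyMap {F : Type*} [Field F] (q n : ℕ) (c : Fin n → F) : F → F :=
  fun x => ∑ i : Fin n, c i * x ^ (q ^ (i : ℕ))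

/-- `L` is (the map induced by) a permutation `q`-polynomial. -/
def IsPermQPoly {F : Type*} [Field F] (q n : ℕ) (L : F → F) : Prop :=
  (∃ c : Fin n → F, L = qPolyMap q n c) ∧ Function.Bijective L

/-- Equivalence of sets of `q`-polynomials: `C' = {L₁ ∘ f ^ ρ ∘ L₂ : f ∈ C}` for some permutation
`q`-polynomials `L₁`, `L₂` and some field automorphism `ρ` of `F`, where `f ^ ρ` is obtained from
`f = ∑ c i * x ^ (q ^ i)` by applying `ρ` to the coefficients. -/
def CodeEquiv {F : Type*} [Field F] (q n : ℕ) (C C' : Set (F → F)) : Prop :=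
  ∃ (L₁ L₂ : F → F) (ρ : F ≃+* F), IsPermQPoly q n L₁ ∧ IsPermQPoly q n L₂ ∧
    C' = {g | ∃ c : Fin n → F, qPolyMap q n c ∈ C ∧
      g = L₁ ∘ qPolyMap q n (fun i => ρ (c i)) ∘ L₂}

/-- The `q`-polynomial
`ψ_{h,t,s} = x^{q^s} + x^{q^{s(t-1)}} + h^{1+q^s} x^{q^{s(t+1)}} + h^{1-q^{s(2t-1)}} x^{q^{s(2t-1)}}`,
as a map on `F`. -/
def psi {F : Type*} [Field F] (q t s : ℕ) (h : F) : F → F :=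
  fun x => x ^ (q ^ s) + x ^ (q ^ (s * (t - 1)))
    + h ^ (1 + q ^ s) * x ^ (q ^ (s * (t + 1)))
    + h ^ (1 - (q : ℤ) ^ (s * (2 * t - 1))) * x ^ (q ^ (s * (2 * t - 1)))

/-- The code `C_{h,t,s} = ⟨x, ψ_{h,t,s}(x)⟩`, an `F`-subspace of the space of maps `F → F`. -/
def codeC {F : Type*} [Field F] (q t s : ℕ) (h : F) : Submodule F (F → F) :=
  Submodule.span F {fun x => x, psi q t s h}

/-!
Write `σ` for the generator `x ↦ x ^ (q ^ s)` of the Galois group of `F` over its subfield with `q`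
elements, so that `ψ_{h,t,s}` is a combination of `σ`, `σ^(t-1)`, `σ^(t+1)` and `σ^(2t-1)`, and the
norm condition reads `h^(σ^t) = -h⁻¹`.  Since `σ^t` is itself a field automorphism, `ρ h = ± k⁻¹` is
solvable in `ρ` if and only if `ρ h = ± k` is; and the congruences listed in the statement exhaust all
residues coprime to `2t`.  What has to be shown is therefore that the two codes are equivalent if and
only if `ρ h = ± k` for some automorphism `ρ`.

*Reduction.*  The left idealiser of a code consists of the multiplications by elements of `F`
(`eq_mul_of_comp_mem_codeC`).  In an equivalence `C' = L₁ ∘ C^ρ ∘ L₂` the additive bijection `L₁ ∘ ρ`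
thus normalises these multiplications, hence is semilinear, and it can be absorbed into `ρ` and `L₂`.
So the codes are equivalent if and only if, for some `ρ`, there is a bijection `M` in `⟨x, ψ_k⟩` such
that `ψ_{ρ h} ∘ M` lies in `⟨x, ψ_k⟩` (`codeEquiv_codeC_iff`).

*One generator.*  Expressed through `σ`, the polynomial `ψ_{k,t,l}` becomes, up to scalars and a
substitution `x ↦ a x`, the polynomial `signedPsi S t ε k'` with `k'` one of `k`, `k⁻¹` and `ε` a
sign, which is `1` for `t = 3`.

*Necessity.*  Let `M = α x + β ψ`.  If `β ≠ 0`, then the coefficient of `σ^t` in `ψ_H ∘ M` must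
vanish.  This equation and its image under `σ^t` form a linear system for conjugates of `β`, which has
a solution only if `H / k` or `H k` is fixed by `σ^t`, i.e. `H = ± k` or `H = ± k⁻¹`
(`eq_or_eq_inv_of_middle_coeff`).  If `β = 0`, comparing the remaining coefficients gives `H = ± k`.

*Sufficiency.*  For `ε = 1` one takes `M = x`.  For `t = 4`, `ε = -1` and odd characteristic, `ψ_k` is
invertible and its inverse is, up to scalars, `signedPsi S 4 (-1) k`
(`spanEquiv_signedPsi_neg_one`).
-/

/-! ### Cyclic systems of field endomorphisms -/

/-- `S 0, S 1, S 2, …` are the powers of a field endomorphism of order exactly `n`.  In the application `S i` is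
`x ↦ x ^ (q ^ (s * i))` with `s` coprime to `n`, that is, the `i`-th power of a generator of the
Galois group of `F` over its subfield with `q` elements. -/
structure IsCyclicSystem {F : Type*} [Field F] (n : ℕ) (S : ℕ → F →+* F) : Prop where
  pos : 0 < n
  zero : ∀ x, S 0 x = x
  comp : ∀ i j x, S i (S j x) = S (i + j) x
  mod : ∀ i x, S i x = S (i % n) x
  inj : ∀ i < n, ∀ j < n, S i = S j → i = j

namespace IsCyclicSystem

variable {F : Type*} [Field F] {n : ℕ} {S : ℕ → F →+* F}

theorem comp_mod (hS : IsCyclicSystem n S) (i j : ℕ) (x : F) :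
    S i (S j x) = S ((i + j) % n) x := by
  rw [hS.comp, hS.mod]

/-- Artin's independence of characters for the powers of the generator. -/
theorem coeff_eq_zero (hS : IsCyclicSystem n S) {m : ℕ} (e : Fin m → ℕ)
    (he : Function.Injective fun i => e i % n) (c : Fin m → F)
    (h : ∀ x, ∑ i, c i * S (e i) x = 0) : ∀ i, c i = 0 := by
  have hinj : Function.Injective fun i => ((S (e i) : F →+* F) : F →* F) := by
    intro i j hij
    apply he
    apply hS.inj _ (Nat.mod_lt _ hS.pos) _ (Nat.mod_lt _ hS.pos)
    ext x
    rw [← hS.mod, ← hS.mod]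
    exact DFunLike.congr_fun hij x
  have := (linearIndependent_monoidHom F F).comp _ hinj
  rw [Fintype.linearIndependent_iff] at this
  apply this
  ext x
  simpa using h x

/-- Hilbert's Theorem 90 for the cyclic group generated by `S d`, of order `m`. -/
theorem exists_mul_eq_self (hS : IsCyclicSystem n S) {d m : ℕ} (hm : 0 < m) (hn : n = d * m)
    (A : F) (hA : ∏ i ∈ Finset.range m, S (d * i) A = 1) : ∃ y, y ≠ 0 ∧ A * S d y = y := by
  set Y : ℕ → F := fun i => ∏ j ∈ Finset.range i, S (d * j) A with hY
  have hd : 0 < d := Nat.pos_of_ne_zero (by rintro rfl; have := hS.pos; simp_all)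
  have hstep : ∀ i, A * S d (Y i) = Y (i + 1) := by
    intro i
    simp only [hY, map_prod, hS.comp, Finset.prod_range_succ']
    rw [mul_comm, mul_zero, hS.zero]
    congr 1
    exact Finset.prod_congr rfl fun j _ => by rw [mul_add, mul_one, add_comm]
  have hfix : ∀ c, A * S d (∑ i ∈ Finset.range m, Y i * S (d * i) c)
      = ∑ i ∈ Finset.range m, Y i * S (d * i) c := by
    intro c
    have h1 : A * S d (∑ i ∈ Finset.range m, Y i * S (d * i) c)
        = ∑ i ∈ Finset.range m, Y (i + 1) * S (d * (i + 1)) c := by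
      rw [map_sum, Finset.mul_sum]
      refine Finset.sum_congr rfl fun i _ => ?_
      rw [map_mul, ← mul_assoc, hstep, hS.comp, mul_add, mul_one, add_comm d]
    have h2 := Finset.sum_range_succ' (fun i => Y i * S (d * i) c) m
    rw [Finset.sum_range_succ] at h2
    have h3 : Y m * S (d * m) c = Y 0 * S (d * 0) c := by
      rw [← hn, hS.mod, Nat.mod_self, mul_zero]
      simp only [hY, hA, Finset.prod_range_zero]
    rw [h1]
    rw [h3] at h2
    exact (add_right_cancel h2).symm
  by_contra! hcon
  have hzero : ∀ c, ∑ i : Fin m, Y i * S (d * i) c = 0 := by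
    intro c
    rw [Fin.sum_univ_eq_sum_range (fun i => Y i * S (d * i) c)]
    by_contra hne
    exact hcon _ hne (hfix c)
  have := hS.coeff_eq_zero (fun i : Fin m => d * i) (by
    intro i j hij
    have hi : d * (i : ℕ) < n := hn ▸ Nat.mul_lt_mul_of_pos_left i.2 hd
    have hj : d * (j : ℕ) < n := hn ▸ Nat.mul_lt_mul_of_pos_left j.2 hd
    simp only [Nat.mod_eq_of_lt hi, Nat.mod_eq_of_lt hj] at hij
    exact Fin.ext (Nat.eq_of_mul_eq_mul_left hd hij)) (fun i => Y i) hzero ⟨0, hm⟩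
  simp [hY] at this

end IsCyclicSystem

theorem pow_pow_mod_eq {F : Type*} [Field F] [Finite F] {q n : ℕ} (hF : Nat.card F = q ^ n) (a : ℕ)
    (x : F) : x ^ (q ^ a) = x ^ (q ^ (a % n)) := by
  have := Fintype.ofFinite F
  rw [Nat.card_eq_fintype_card] at hF
  conv_lhs => rw [← Nat.mod_add_div a n, pow_add, pow_mul, pow_mul q n, ← hF,
    FiniteField.pow_card_pow]

/-- For `s` coprime to `n`, the powers of `x ↦ x ^ (q ^ s)` form a cyclic system of order `n` on the
field with `q ^ n` elements. -/
theorem exists_isCyclicSystem {F : Type*} [Field F] [Finite F] {q n s : ℕ} (hq : IsPrimePow q)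
    (hn : 0 < n) (hF : Nat.card F = q ^ n) (hs : Nat.Coprime s n) :
    ∃ S : ℕ → F →+* F, IsCyclicSystem n S ∧ ∀ i x, S i x = x ^ (q ^ (s * i)) := by
  obtain ⟨p, e, hp, he, rfl⟩ := hq
  have hp := hp.nat_prime
  have : Fact p.Prime := ⟨hp⟩
  have hq1 : 1 < p ^ e := Nat.one_lt_pow he.ne' hp.one_lt
  have : CharP F p := by
    obtain ⟨p', hp'⟩ := CharP.exists F
    have := Fintype.ofFinite F
    obtain ⟨k, hp1, hk⟩ := FiniteField.card F p'
    rw [← Nat.card_eq_fintype_card, hF, ← pow_mul] at hk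
    have : p ∣ p' ^ (k : ℕ) := hk ▸ dvd_pow_self p (Nat.mul_pos he hn).ne'
    rwa [(Nat.prime_dvd_prime_iff_eq hp hp1).1 (hp.dvd_of_dvd_pow this)]
  refine ⟨fun i => iterateFrobenius F p (e * (s * i)), ?_, ?_⟩
  swap
  · intro i x
    rw [iterateFrobenius_def, pow_mul]
  have hdef : ∀ i (x : F), iterateFrobenius F p (e * (s * i)) x = x ^ ((p ^ e) ^ (s * i)) := by
    intro i x
    rw [iterateFrobenius_def, pow_mul]
  refine ⟨hn, ?_, ?_, ?_, ?_⟩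
  · intro x; simp
  · intro i j x
    rw [hdef, hdef, hdef, ← pow_mul, ← pow_add, mul_add, add_comm]
  · intro i x
    rw [hdef, hdef, pow_pow_mod_eq hF, pow_pow_mod_eq hF (s * (i % n))]
    simp [Nat.mul_mod]
  -- A generator of the unit group separates the powers of Frobenius below `n`.
  · have key : ∀ a b, a < n → b < n → a ≤ b →
        (∀ x : F, x ^ ((p ^ e) ^ a) = x ^ ((p ^ e) ^ b)) → a = b := by
      intro a b ha hb hab h
      obtain ⟨g, hg⟩ := IsCyclic.exists_ofOrder_eq_natCard (α := Fˣ)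
      have h1 : g ^ ((p ^ e) ^ a) = g ^ ((p ^ e) ^ b) := by
        ext; simpa using h g
      have hcard : Nat.card Fˣ = (p ^ e) ^ n - 1 := by rw [Nat.card_units, hF]
      have hlt : ∀ c, c < n → (p ^ e) ^ c < (p ^ e) ^ n - 1 ∨ (p ^ e) ^ c = (p ^ e) ^ n - 1 := by
        intro c hc
        have := Nat.pow_lt_pow_right hq1 hc
        omega
      rw [pow_inj_mod, hg, hcard] at h1
      have hpos : ∀ c, 0 < (p ^ e) ^ c := fun c => pow_pos (by omega) c
      by_contra hne
      have hlt' : a < b := lt_of_le_of_ne hab hne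
      have hpab := Nat.pow_lt_pow_right hq1 hlt'
      have h2 := hpos a
      rcases hlt b hb with hb' | hb'
      · rw [Nat.mod_eq_of_lt hb', Nat.mod_eq_of_lt (hpab.trans hb')] at h1
        omega
      · rw [← hb', Nat.mod_self, Nat.mod_eq_of_lt hpab] at h1
        omega
    have key' : ∀ a b, a < n → b < n → (∀ x : F, x ^ ((p ^ e) ^ a) = x ^ ((p ^ e) ^ b)) →
        a = b := by
      intro a b ha hb h
      rcases le_total a b with hab | hab
      · exact key a b ha hb hab h
      · exact (key b a hb ha hab fun x => (h x).symm).symm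
    intro i hi j hj hij
    have h1 : s * i % n = s * j % n := by
      apply key' _ _ (Nat.mod_lt _ hn) (Nat.mod_lt _ hn)
      intro x
      rw [← pow_pow_mod_eq hF, ← pow_pow_mod_eq hF, ← hdef, ← hdef, hij]
    have h2 : i ≡ j [MOD n] := Nat.ModEq.cancel_left_of_coprime
      (by rw [Nat.coprime_comm] at hs; exact hs) h1
    rwa [Nat.ModEq, Nat.mod_eq_of_lt hi, Nat.mod_eq_of_lt hj] at h2

/-! ### Reduction of the equivalence of codes to the existence of a change of variable -/

/-- The relation `⟨x, f⟩ ∘ M = ⟨x, g⟩` for some bijection `M`, in the form in which it is used: `M`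
and `f ∘ M` lie in `⟨x, g⟩`.  If `f` is not a multiple of `x`, the two forms agree by dimension. -/
def SpanEquiv {F : Type*} [Field F] (f g : F → F) : Prop :=
  ∃ M : F → F, Function.Bijective M ∧ M ∈ Submodule.span F {fun x => x, g} ∧
    f ∘ M ∈ Submodule.span F {fun x => x, g}

theorem map_psi {F : Type*} [Field F] (q t s : ℕ) (h : F) (ρ : F ≃+* F) (x : F) :
    ρ (psi q t s h x) = psi q t s (ρ h) (ρ x) := by
  simp [psi]

/-- Applying `ρ` to the coefficients of a `q`-polynomial amounts to conjugating by `ρ`. -/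
theorem qPolyMap_map {F : Type*} [Field F] (q n : ℕ) (c : Fin n → F) (ρ : F ≃+* F) :
    qPolyMap q n (fun i => ρ (c i)) = ρ ∘ qPolyMap q n c ∘ ρ.symm := by
  ext x
  simp [qPolyMap]

section

variable {F : Type*} [Field F] {q t : ℕ}

theorem psi_apply_eq {s : ℕ} {S : ℕ → F →+* F} (hSx : ∀ i x, S i x = x ^ (q ^ (s * i))) {h : F}
    (hh : h ≠ 0) (x : F) :
    psi q t s h x = S 1 x + S (t - 1) x + h * S 1 h * S (t + 1) x
      + h / S (2 * t - 1) h * S (2 * t - 1) x := by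
  have h1 : h ^ (1 - (q : ℤ) ^ (s * (2 * t - 1))) = h / h ^ (q ^ (s * (2 * t - 1))) := by
    rw [zpow_sub₀ hh, zpow_one, ← zpow_natCast h (q ^ (s * (2 * t - 1)))]
    push_cast
    rfl
  simp only [psi, h1, hSx, mul_one, pow_add, pow_one]

/-- The five monomials that occur in `⟨x, ψ⟩` are independent; the coefficients of `σ` and `σ^(t-1)`
are the ones used. -/
theorem five_coeff_eq_zero (ht : 3 ≤ t) {S : ℕ → F →+* F} (hS : IsCyclicSystem (2 * t) S)
    {c₀ c₁ c₂ c₃ c₄ : F} (h : ∀ x, c₀ * x + c₁ * S 1 x + c₂ * S (t - 1) x + c₃ * S (t + 1) x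
      + c₄ * S (2 * t - 1) x = 0) : c₁ = 0 ∧ c₂ = 0 := by
  have := hS.coeff_eq_zero ![0, 1, t - 1, t + 1, 2 * t - 1] (by
    have e : (fun i => (![0, 1, t - 1, t + 1, 2 * t - 1] : Fin 5 → ℕ) i % (2 * t))
        = ![0, 1, t - 1, t + 1, 2 * t - 1] := by
      ext i
      apply Nat.mod_eq_of_lt
      fin_cases i <;> simp <;> omega
    rw [e]
    intro i j hij
    fin_cases i <;> fin_cases j <;> simp at hij ⊢ <;> omega) ![c₀, c₁, c₂, c₃, c₄] (by
      intro x
      simpa [Fin.sum_univ_five, hS.zero] using h x)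
  exact ⟨this 1, this 2⟩

theorem psi_ne_mul (ht : 3 ≤ t) {s : ℕ} {S : ℕ → F →+* F} (hS : IsCyclicSystem (2 * t) S)
    (hSx : ∀ i x, S i x = x ^ (q ^ (s * i))) {h : F} (hh : h ≠ 0) (c : F) :
    ¬ ∀ x, psi q t s h x = c * x := by
  intro H
  have := five_coeff_eq_zero ht hS (c₀ := -c) (c₁ := 1) (c₂ := 1) (c₃ := h * S 1 h)
    (c₄ := h / S (2 * t - 1) h) (by
      intro x
      have := H x
      rw [psi_apply_eq hSx hh] at this
      linear_combination this)
  exact one_ne_zero this.1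

/-- The left idealiser of the code consists of the multiplications by scalars. -/
theorem eq_mul_of_comp_mem_codeC (ht : 3 ≤ t) {s : ℕ} {S : ℕ → F →+* F}
    (hS : IsCyclicSystem (2 * t) S) (hSx : ∀ i x, S i x = x ^ (q ^ (s * i))) {h : F} (hh : h ≠ 0)
    (φ : F → F) (hφ : ∀ g ∈ codeC q t s h, φ ∘ g ∈ codeC q t s h) : ∃ μ, ∀ y, φ y = μ * y := by
  have hid : (fun x : F => x) ∈ codeC q t s h := Submodule.subset_span (by simp)
  obtain ⟨a, b, hab⟩ := Submodule.mem_span_pair.1 (hφ _ hid)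
  have hφx : ∀ x, φ x = a * x + b * psi q t s h x := fun x => (congrFun hab x).symm
  have key : ∀ c, b * (S 1 c - S (t - 1) c) = 0 := by
    intro c
    obtain ⟨γ, δ, hγ⟩ := Submodule.mem_span_pair.1 (hφ _ ((codeC q t s h).smul_mem c hid))
    have := five_coeff_eq_zero ht hS (c₀ := a * c - γ) (c₁ := b * S 1 c - δ)
      (c₂ := b * S (t - 1) c - δ) (c₃ := (b * S (t + 1) c - δ) * (h * S 1 h))
      (c₄ := (b * S (2 * t - 1) c - δ) * (h / S (2 * t - 1) h)) (by
        intro x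
        have h1 := congrFun hγ x
        simp only [Pi.add_apply, Pi.smul_apply, smul_eq_mul, Function.comp_apply, hφx,
          psi_apply_eq hSx hh, map_mul] at h1
        linear_combination -h1)
    linear_combination this.1 - this.2
  have hb : b = 0 := by
    by_contra hb
    have : S 1 = S (t - 1) := by
      ext c
      exact sub_eq_zero.1 ((mul_eq_zero.1 (key c)).resolve_left hb)
    have := hS.inj _ (by omega) _ (by omega) this
    omega
  exact ⟨a, fun y => by rw [hφx, hb, zero_mul, add_zero]⟩

variable [Finite F]

theorem qPolyMap_add (hq : IsPrimePow q) {n : ℕ} (hn : 0 < n) (hF : Nat.card F = q ^ n)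
    (c : Fin n → F) (x y : F) : qPolyMap q n c (x + y) = qPolyMap q n c x + qPolyMap q n c y := by
  obtain ⟨S, -, hS⟩ := exists_isCyclicSystem hq hn hF (Nat.coprime_one_left n)
  have hS' : ∀ (i : ℕ) (x : F), x ^ q ^ i = S i x := by intro i x; rw [hS, one_mul]
  simp only [qPolyMap, hS', map_add, mul_add, Finset.sum_add_distrib]

theorem exists_qPolyMap_eq_monomial {n : ℕ} (hn : 0 < n) (hF : Nat.card F = q ^ n) (a : F) (m : ℕ) :
    ∃ c : Fin n → F, qPolyMap q n c = fun x => a * x ^ (q ^ m) := by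
  refine ⟨Pi.single ⟨m % n, Nat.mod_lt _ hn⟩ a, ?_⟩
  ext x
  rw [qPolyMap, Finset.sum_eq_single ⟨m % n, Nat.mod_lt _ hn⟩]
  · rw [Pi.single_eq_same, pow_pow_mod_eq hF m]
  · intro i _ hi
    rw [Pi.single_eq_of_ne hi, zero_mul]
  · simp

theorem exists_qPolyMap_eq_of_mem_codeC (ht : 0 < 2 * t) (hF : Nat.card F = q ^ (2 * t)) {s : ℕ}
    {h : F} {f : F → F} (hf : f ∈ codeC q t s h) : ∃ c : Fin (2 * t) → F, f = qPolyMap q (2 * t) c := by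
  obtain ⟨a, b, rfl⟩ := Submodule.mem_span_pair.1 hf
  obtain ⟨c0, h0⟩ := exists_qPolyMap_eq_monomial ht hF a 0
  obtain ⟨c1, h1⟩ := exists_qPolyMap_eq_monomial ht hF b s
  obtain ⟨c2, h2⟩ := exists_qPolyMap_eq_monomial ht hF b (s * (t - 1))
  obtain ⟨c3, h3⟩ := exists_qPolyMap_eq_monomial ht hF (b * h ^ (1 + q ^ s)) (s * (t + 1))
  obtain ⟨c4, h4⟩ := exists_qPolyMap_eq_monomial ht hF
    (b * h ^ (1 - (q : ℤ) ^ (s * (2 * t - 1)))) (s * (2 * t - 1))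
  refine ⟨fun i => c0 i + c1 i + c2 i + c3 i + c4 i, ?_⟩
  ext x
  have hsum : qPolyMap q (2 * t) (fun i => c0 i + c1 i + c2 i + c3 i + c4 i) x
      = qPolyMap q (2 * t) c0 x + qPolyMap q (2 * t) c1 x + qPolyMap q (2 * t) c2 x
        + qPolyMap q (2 * t) c3 x + qPolyMap q (2 * t) c4 x := by
    simp only [qPolyMap, add_mul, Finset.sum_add_distrib]
  rw [hsum, h0, h1, h2, h3, h4]
  simp only [psi, Pi.add_apply, Pi.smul_apply, smul_eq_mul, pow_zero, pow_one]
  ring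

/-- An additive bijection that normalises the multiplications by scalars is semilinear. -/
theorem exists_eq_mul_ringEquiv {A : F → F} (hA : Function.Bijective A)
    (hadd : ∀ x y, A (x + y) = A x + A y) (h : ∀ a, ∃ μ, ∀ z, A (a * z) = μ * A z) :
    ∃ (c : F) (τ : F ≃+* F), c ≠ 0 ∧ ∀ x, A x = c * τ x := by
  choose μ hμ using h
  have h0 : A 0 = 0 := by simpa using hadd 0 0
  have h1 : A 1 ≠ 0 := fun h => one_ne_zero (hA.1 (h.trans h0.symm))
  have hAμ : ∀ a, A a = A 1 * μ a := fun a => by rw [mul_comm, ← hμ a 1, mul_one]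
  let τ : F →+* F :=
    { toFun := μ
      map_one' := mul_left_cancel₀ h1 (by rw [← hAμ, mul_one])
      map_zero' := mul_left_cancel₀ h1 (by rw [← hAμ, mul_zero, h0])
      map_mul' := fun x y => mul_left_cancel₀ h1 (by rw [← hAμ, hμ, hAμ y]; ring)
      map_add' := fun x y => mul_left_cancel₀ h1 (by rw [← hAμ, hadd, hAμ x, hAμ y, mul_add]) }
  have hτ : Function.Bijective τ := Finite.injective_iff_bijective.1 τ.injective
  exact ⟨A 1, RingEquiv.ofBijective τ hτ, h1, hAμ⟩

theorem codeEquiv_codeC_iff (hq : IsPrimePow q) (ht : 3 ≤ t) (hF : Nat.card F = q ^ (2 * t))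
    {h k : F} (hh : h ≠ 0) (hk : k ≠ 0) {s l : ℕ} (hs : Nat.Coprime s (2 * t))
    (hl : Nat.Coprime l (2 * t)) :
    CodeEquiv q (2 * t) (codeC q t s h : Set (F → F)) (codeC q t l k : Set (F → F)) ↔
      ∃ ρ : F ≃+* F, SpanEquiv (psi q t s (ρ h)) (psi q t l k) := by
  have hn : 0 < 2 * t := by omega
  obtain ⟨S, hS, hSx⟩ := exists_isCyclicSystem hq hn hF hs
  obtain ⟨T, hT, hTx⟩ := exists_isCyclicSystem hq hn hF hl
  have hid : ∀ s (h : F), (fun x : F => x) ∈ codeC q t s h := fun s h =>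
    Submodule.subset_span (by simp)
  have hpsi : ∀ s (h : F), psi q t s h ∈ codeC q t s h := fun s h =>
    Submodule.subset_span (by simp)
  constructor
  · rintro ⟨L₁, L₂, ρ, ⟨⟨c₁, hc₁⟩, hL₁⟩, ⟨-, hL₂⟩, hC⟩
    set A : F → F := L₁ ∘ ρ with hA
    set B : F → F := ρ.symm ∘ L₂ with hB
    have hAbij : Function.Bijective A := hL₁.comp ρ.bijective
    have hBbij : Function.Bijective B := ρ.symm.bijective.comp hL₂
    have hmem : ∀ g, g ∈ codeC q t l k ↔ ∃ f ∈ codeC q t s h, g = A ∘ f ∘ B := by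
      intro g
      rw [← SetLike.mem_coe, hC]
      constructor
      · rintro ⟨c, hc, rfl⟩
        exact ⟨_, hc, by rw [qPolyMap_map]; rfl⟩
      · rintro ⟨f, hf, rfl⟩
        obtain ⟨c, rfl⟩ := exists_qPolyMap_eq_of_mem_codeC hn hF hf
        exact ⟨c, hf, by rw [qPolyMap_map]; rfl⟩
    obtain ⟨c, τ, hc, hAτ⟩ := exists_eq_mul_ringEquiv hAbij (by
        intro x y
        simp only [hA, Function.comp_apply, map_add, hc₁, qPolyMap_add hq hn hF]) (by
        intro a
        -- Conjugation by `A` carries multiplication by `a` into the left idealiser of the code.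
        obtain ⟨μ, hμ⟩ := eq_mul_of_comp_mem_codeC ht hT hTx hk
          (fun y => A (a * (Equiv.ofBijective A hAbij).symm y)) (by
            intro g hg
            obtain ⟨f, hf, rfl⟩ := (hmem g).1 hg
            refine (hmem _).2 ⟨a • f, Submodule.smul_mem _ _ hf, ?_⟩
            ext x
            simp only [Function.comp_apply, Pi.smul_apply, smul_eq_mul]
            rw [Equiv.ofBijective_symm_apply_apply])
        exact ⟨μ, fun z => by
          rw [← hμ, Equiv.ofBijective_symm_apply_apply]⟩)
    refine ⟨τ, τ ∘ B, τ.bijective.comp hBbij, ?_, ?_⟩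
    · have h1 : τ ∘ B = c⁻¹ • (A ∘ (fun x => x) ∘ B) := by
        ext x
        simp only [Pi.smul_apply, Function.comp_apply, smul_eq_mul, hAτ, inv_mul_cancel_left₀ hc]
      rw [h1]
      exact Submodule.smul_mem _ c⁻¹ ((hmem _).2 ⟨_, hid s h, rfl⟩)
    · have h1 : psi q t s (τ h) ∘ τ ∘ B = c⁻¹ • (A ∘ psi q t s h ∘ B) := by
        ext x
        simp only [Pi.smul_apply, Function.comp_apply, smul_eq_mul, hAτ, map_psi,
          inv_mul_cancel_left₀ hc]
      rw [h1]
      exact Submodule.smul_mem _ c⁻¹ ((hmem _).2 ⟨_, hpsi s h, rfl⟩)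
  · rintro ⟨ρ, M, hM, hM1, hM2⟩
    have hidq := exists_qPolyMap_eq_of_mem_codeC hn hF (hid s h)
    have hMq := exists_qPolyMap_eq_of_mem_codeC hn hF (s := l) (h := k) hM1
    -- `⟨M, ψ ∘ M⟩` and `⟨x, ψ'⟩` agree, because both have dimension two.
    have hspan : Submodule.span F {M, psi q t s (ρ h) ∘ M} = codeC q t l k := by
      have : FiniteDimensional F (codeC q t l k) :=
        FiniteDimensional.span_of_finite F (Set.toFinite _)
      apply Submodule.eq_of_le_of_finrank_le
      · rw [Submodule.span_le]
        rintro g (rfl | rfl)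
        · exact hM1
        · exact hM2
      · have hli : LinearIndependent F ![M, psi q t s (ρ h) ∘ M] := by
          rw [LinearIndependent.pair_iff]
          intro a b hab
          have hab' : ∀ y, a * y + b * psi q t s (ρ h) y = 0 := by
            intro y
            obtain ⟨x, rfl⟩ := hM.2 y
            exact congrFun hab x
          have hb : b = 0 := by
            by_contra hb
            refine psi_ne_mul ht hS hSx (h := ρ h) (by simpa using hh) (-a / b) fun x => ?_
            rw [div_mul_eq_mul_div, eq_div_iff hb]
            linear_combination hab' x
          have := hab' 1
          rw [hb] at this
          exact ⟨by simpa using this, hb⟩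
        have h2 := finrank_span_eq_card hli
        rw [Matrix.range_cons, Matrix.range_cons, Matrix.range_empty, Set.union_empty,
          Set.singleton_union, Fintype.card_fin] at h2
        rw [h2]
        classical
        refine (finrank_span_le_card _).trans ?_
        rw [Set.toFinset_insert, Set.toFinset_singleton]
        exact Finset.card_le_two
    refine ⟨fun x => x, M, ρ, ⟨hidq, Function.bijective_id⟩, ⟨hMq, hM⟩, ?_⟩
    ext g
    rw [SetLike.mem_coe, ← hspan, Submodule.mem_span_pair]
    constructor
    · rintro ⟨a, b, rfl⟩
      obtain ⟨c, hc⟩ := exists_qPolyMap_eq_of_mem_codeC hn hF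
        (Submodule.add_mem _ (Submodule.smul_mem _ (ρ.symm a) (hid s h))
          (Submodule.smul_mem _ (ρ.symm b) (hpsi s h)))
      refine ⟨c, ?_, ?_⟩
      · rw [← hc]
        exact Submodule.add_mem _ (Submodule.smul_mem _ (ρ.symm a) (hid s h))
          (Submodule.smul_mem _ (ρ.symm b) (hpsi s h))
      · rw [qPolyMap_map, ← hc]
        ext x
        simp [map_psi]
    · rintro ⟨c, hc, rfl⟩
      obtain ⟨a, b, hab⟩ := Submodule.mem_span_pair.1 hc
      refine ⟨ρ a, ρ b, ?_⟩
      rw [qPolyMap_map, ← hab]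
      ext x
      simp [map_psi]

end

theorem SpanEquiv.of_comp_mul {F : Type*} [Field F] {f g g' : F → F} {a d : F} (ha : a ≠ 0)
    (hg : ∀ x, g x = d * g' (a * x)) (h : SpanEquiv f g) : SpanEquiv f g' := by
  have hmem : ∀ M ∈ Submodule.span F {fun x => x, g},
      (fun x => M (a⁻¹ * x)) ∈ Submodule.span F {fun x => x, g'} := by
    intro M hM
    obtain ⟨u, v, rfl⟩ := Submodule.mem_span_pair.1 hM
    refine Submodule.mem_span_pair.2 ⟨u * a⁻¹, v * d, ?_⟩
    ext x
    simp [hg, mul_inv_cancel_left₀ ha, mul_assoc]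
  obtain ⟨M, hM, h1, h2⟩ := h
  exact ⟨fun x => M (a⁻¹ * x), hM.comp (mulLeft_bijective₀ _ (inv_ne_zero ha)), hmem _ h1,
    hmem _ h2⟩

theorem spanEquiv_comp_mul_iff {F : Type*} [Field F] {f g g' : F → F} {a d : F} (ha : a ≠ 0)
    (hd : d ≠ 0) (hg : ∀ x, g x = d * g' (a * x)) : SpanEquiv f g ↔ SpanEquiv f g' := by
  refine ⟨SpanEquiv.of_comp_mul ha hg, SpanEquiv.of_comp_mul (a := a⁻¹) (d := d⁻¹)
    (inv_ne_zero ha) fun x => ?_⟩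
  rw [hg, mul_inv_cancel_left₀ ha, inv_mul_cancel_left₀ hd]

/-! ### Necessity: comparing coefficients -/

/-- The four-term `q`-polynomial
`x^σ + x^(σ^(t-1)) + ε (k^(1+σ) x^(σ^(t+1)) - k^(1+σ^(t-1)) x^(σ^(2t-1)))`, where `S i = σ ^ i`.  If
`k^(σ^t) = -k⁻¹`, then the sign `ε = 1` gives `ψ_k`; for `t = 4`, replacing the generator `σ` by
`σ ^ 3` in `ψ_k` changes the sign to `ε = -1`. -/
def signedPsi {F : Type*} [Field F] (S : ℕ → F →+* F) (t : ℕ) (ε k : F) : F → F :=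
  fun x => S 1 x + S (t - 1) x
    + ε * (k * S 1 k * S (t + 1) x - k * S (t - 1) k * S (2 * t - 1) x)

section

variable {F : Type*} [Field F] {t : ℕ} {S : ℕ → F →+* F} {H k : F}

theorem IsCyclicSystem.map_inv_of_norm (hS : IsCyclicSystem (2 * t) S) {i : ℕ}
    (hk : S t k = -k⁻¹) : S (t + i) k = -(S i k)⁻¹ := by
  rw [add_comm, ← hS.comp, hk, map_neg, map_inv₀]

theorem eq_or_neg_eq_of_fixed {H k : F} (hH0 : H ≠ 0) (hk0 : k ≠ 0) (hH : S t H = -H⁻¹)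
    (hk : S t k = -k⁻¹) (h : S t (H / k) = H / k) : H = k ∨ H = -k := by
  rw [map_div₀, hH, hk, neg_div_neg_eq, inv_div_inv, div_eq_div_iff hH0 hk0] at h
  rcases sq_eq_sq_iff_eq_or_eq_neg.1 (show H ^ 2 = k ^ 2 by linear_combination -h) with h | h
  · exact Or.inl h
  · exact Or.inr h

theorem IsCyclicSystem.fixed_of_map_one_eq (hS : IsCyclicSystem (2 * t) S) (ht : 3 ≤ t) {u : F}
    (h : S 1 u = S (t - 1) u) : S (t - 2) u = u := by
  apply (S 1).injective
  rw [hS.comp, h]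
  congr 2
  omega

/-- If `x ↦ α x` carries `ψ_H` to a multiple of `signedPsi S t ε k`, then `H = ± k`. -/
theorem eq_or_neg_eq_of_mul_eq (hS : IsCyclicSystem (2 * t) S) (ht : 3 ≤ t)
    (hfix : ∀ u, S (t - 2) u = u → S t u = u) (hH0 : H ≠ 0) (hk0 : k ≠ 0)
    (hH : S t H = -H⁻¹) (hk : S t k = -k⁻¹) {ε : F}
    (h1 : H * S 1 H = ε * (k * S 1 k)) (hm : H * S (t - 1) H = ε * (k * S (t - 1) k)) :
    H = k ∨ H = -k := by
  refine eq_or_neg_eq_of_fixed hH0 hk0 hH hk (hfix _ (hS.fixed_of_map_one_eq ht ?_))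
  have hk1 : S 1 k ≠ 0 := by simpa using hk0
  have hkm : S (t - 1) k ≠ 0 := by simpa using hk0
  rw [map_div₀, map_div₀, div_eq_div_iff hk1 hkm]
  apply mul_left_cancel₀ hH0
  linear_combination S (t - 1) k * h1 - S 1 k * hm

/-- The vanishing of the coefficient of `x^(σ^t)` in `ψ_H ∘ (α x + β g)`, with
`g = signedPsi S t ε k` and `β ≠ 0`, already forces `H = ± k` or `H = ± k⁻¹`: together with its image
under `σ^t` it is a linear system for the conjugates of `β`, which can only be solved if `H / k` or
`H k` is fixed by `σ^t`. -/
theorem eq_or_eq_inv_of_middle_coeff (hS : IsCyclicSystem (2 * t) S) (ht : 3 ≤ t)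
    (hfix : ∀ u, S (t - 2) u = u → S t u = u) (hH0 : H ≠ 0) (hk0 : k ≠ 0)
    (hH : S t H = -H⁻¹) (hk : S t k = -k⁻¹) {ε : F} (hε : ε = 1 ∨ ε = -1) {β : F} (hβ : β ≠ 0)
    (h : S 1 β + S (t - 1) β = ε * k * H * (S 1 H * S (t + 1) k * S (t + 1) β
      + S (t - 1) H * S (2 * t - 1) k * S (2 * t - 1) β)) :
    (H = k ∨ H = -k) ∨ (H = k⁻¹ ∨ H = -k⁻¹) := by
  have hnz : ∀ i {z : F}, z ≠ 0 → S i z ≠ 0 := fun i z hz => by simpa using hz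
  have hSε : ∀ i, S i ε = ε := by
    intro i
    rcases hε with rfl | rfl <;> simp
  have hε2 : ε * ε = 1 := by rcases hε with rfl | rfl <;> ring
  have e1 : 2 * t - 1 = t + (t - 1) := by omega
  have e2 : ∀ z, S (t + (t + 1)) z = S 1 z := fun z => by
    rw [hS.mod, show t + (t + 1) = 1 + 2 * t by ring, Nat.add_mod_right,
      Nat.mod_eq_of_lt (by omega)]
  have e3 : ∀ z, S (t + (2 * t - 1)) z = S (t - 1) z := fun z => by
    rw [hS.mod, show t + (2 * t - 1) = t - 1 + 2 * t by omega, Nat.add_mod_right,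
      Nat.mod_eq_of_lt (by omega)]
  have h' := congrArg (S t) h
  simp only [map_add, map_mul, hSε, hS.comp, hH, hk, e2, e3] at h'
  rw [e1] at h
  rw [hS.map_inv_of_norm hH, hS.map_inv_of_norm hH] at h'
  rw [hS.map_inv_of_norm hk, hS.map_inv_of_norm hk] at h
  have hshift : S (t - 2) (S (t + 1) β) = S (t + (t - 1)) β := by
    rw [hS.comp]; congr 2; omega
  have hshift1 : ∀ z, S (t - 2) (S 1 z) = S (t - 1) z := by
    intro z; rw [hS.comp]; congr 2; omega
  have hH1 := hnz 1 hH0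
  have hk1 := hnz 1 hk0
  have hHm := hnz (t - 1) hH0
  have hkm := hnz (t - 1) hk0
  have hβm := hnz (t + (t - 1)) hβ
  by_cases hr : S 1 H * S (t - 1) k = S (t - 1) H * S 1 k
  · left
    refine eq_or_neg_eq_of_fixed hH0 hk0 hH hk (hfix _ (hS.fixed_of_map_one_eq ht ?_))
    rw [map_div₀, map_div₀, div_eq_div_iff hk1 hkm, hr]
  · right
    rw [show t + (t - 1) = 2 * t - 1 by omega] at h h' hshift hβm
    -- Solve the linear system for the two conjugates of `β`.
    have hsol : ε * k * H * S 1 H * S (t + 1) β = -(S 1 k * S 1 β) ∧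
        ε * k * H * S (t - 1) H * S (2 * t - 1) β = -(S (t - 1) k * S (t - 1) β) := by
      generalize S 1 H = H1 at *
      generalize S 1 k = k1 at *
      generalize S (t - 1) H = Hm at *
      generalize S (t - 1) k = km at *
      generalize S 1 β = b1 at *
      generalize S (t - 1) β = bm at *
      generalize S (t + 1) β = c1 at *
      generalize S (2 * t - 1) β = cm at *
      have hE : km * (ε * k * H * H1 * c1 + k1 * b1) + k1 * (ε * k * H * Hm * cm + km * bm) = 0 := by
        field_simp at h
        linear_combination h
      have hE' : Hm * (ε * k * H * H1 * c1 + k1 * b1) + H1 * (ε * k * H * Hm * cm + km * bm) = 0 := by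
        field_simp at h'
        linear_combination ε * h' - (k1 * b1 * Hm + km * bm * H1) * hε2
      have hr' : H1 * km - Hm * k1 ≠ 0 := sub_ne_zero.2 hr
      constructor
      · apply mul_left_cancel₀ hr'
        linear_combination H1 * hE - k1 * hE'
      · apply mul_left_cancel₀ hr'
        linear_combination km * hE' - Hm * hE
    have h3 := congrArg (S (t - 2)) hsol.1
    simp only [map_mul, map_neg, hSε, hshift1, hshift] at h3
    have h4 : S (t - 2) (k * H) = k * H := by
      have : (S (t - 2) (k * H) - k * H) * (ε * S (t - 1) H * S (2 * t - 1) β) = 0 := by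
        rw [map_mul]
        linear_combination h3 - hsol.2
      have hε0 : ε ≠ 0 := left_ne_zero_of_mul (hε2.trans_ne one_ne_zero)
      exact sub_eq_zero.1 ((mul_eq_zero.1 this).resolve_right
        (mul_ne_zero (mul_ne_zero hε0 hHm) hβm))
    have h5 := hfix _ h4
    refine eq_or_neg_eq_of_fixed hH0 (inv_ne_zero hk0) hH ?_ ?_
    · exact by rw [map_inv₀, hk, inv_neg]
    · rwa [div_inv_eq_mul, mul_comm H k]

theorem ne_zero_of_bijective_mul {α : F} (h : Function.Bijective fun x : F => α * x) : α ≠ 0 := by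
  rintro rfl
  exact one_ne_zero (h.1 (by simp : (0 : F) * 1 = 0 * 0))

theorem SpanEquiv.eq_or_eq_inv_three {S : ℕ → F →+* F} (hS : IsCyclicSystem 6 S)
    (hH0 : H ≠ 0) (hk0 : k ≠ 0) (hH : S 3 H = -H⁻¹) (hk : S 3 k = -k⁻¹)
    (h : SpanEquiv (signedPsi S 3 1 H) (signedPsi S 3 1 k)) :
    (H = k ∨ H = -k) ∨ (H = k⁻¹ ∨ H = -k⁻¹) := by
  have hfix : ∀ u, S (3 - 2) u = u → S 3 u = u := by
    intro u hu
    rw [← hS.comp 1 2, ← hS.comp 1 1, hu, hu, hu]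
  obtain ⟨M, hM, h1, h2⟩ := h
  obtain ⟨α, β, rfl⟩ := Submodule.mem_span_pair.1 h1
  obtain ⟨γ, δ, h2⟩ := Submodule.mem_span_pair.1 h2
  have hc := hS.coeff_eq_zero (m := 6) (fun i => i) (by decide)
    ![-(S 1 β * S 1 k * S 3 k) + S 2 β * S 2 k * S 3 k + H * S 1 H * S 4 β
        - H * S 2 H * S 5 β - γ,
      S 1 α - S 2 β * S 2 k * S 4 k - H * S 2 H * S 5 β - δ,
      S 2 α + S 1 β + H * S 1 H * S 4 β * S 4 k * S 5 k - δ,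
      S 1 β + S 2 β - H * S 1 H * S 4 β * S 4 k * k - H * S 2 H * S 5 β * S 5 k * k,
      H * S 1 H * S 4 α + S 2 β + H * S 2 H * S 5 β * S 5 k * S 1 k - δ * k * S 1 k,
      -(H * S 2 H * S 5 α) + S 1 β * S 1 k * S 2 k + H * S 1 H * S 4 β + δ * k * S 2 k] (by
    intro x
    have := congrFun h2 x
    simp only [signedPsi, Function.comp_apply, Pi.add_apply, Pi.smul_apply, smul_eq_mul, map_add,
      map_mul, map_sub, hS.comp_mod, one_mul, Nat.reduceAdd, Nat.reduceSub, Nat.reduceMul,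
      Nat.reduceMod, hS.zero] at this
    simp [Fin.sum_univ_succ, hS.zero]
    linear_combination -this)
  by_cases hβ : β = 0
  · left
    have hα : α ≠ 0 := ne_zero_of_bijective_mul (by
      convert hM using 1
      ext x
      simp [hβ])
    have c1 := hc 1
    have c2 := hc 2
    have c4 := hc 4
    have c5 := hc 5
    simp [hβ] at c1 c2 c4 c5
    have hα1 : S 1 α = α := hS.fixed_of_map_one_eq (t := 3) le_rfl (by
      simp only [Nat.reduceSub]
      linear_combination c1 - c2)
    have hα4 : S 4 α = α := by
      rw [← hS.comp 1 3, ← hS.comp 1 2, ← hS.comp 1 1, hα1, hα1, hα1, hα1]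
    have hα5 : S 5 α = α := by rw [← hS.comp 1 4, hα4, hα1]
    rw [hα1] at c1
    rw [hα4] at c4
    rw [hα5] at c5
    refine eq_or_neg_eq_of_mul_eq (t := 3) (ε := 1) hS le_rfl hfix hH0 hk0 hH hk ?_ ?_ <;>
      apply mul_left_cancel₀ hα
    · linear_combination c4 - k * S 1 k * c1
    · simp only [Nat.reduceSub]
      linear_combination -c5 - k * S 2 k * c1
  · refine eq_or_eq_inv_of_middle_coeff (t := 3) hS le_rfl hfix hH0 hk0 hH hk (Or.inl rfl) hβ ?_
    have c3 := hc 3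
    simp at c3
    simp only [Nat.reduceAdd, Nat.reduceSub, Nat.reduceMul]
    linear_combination c3

theorem SpanEquiv.eq_or_eq_inv_four {S : ℕ → F →+* F} (hS : IsCyclicSystem 8 S)
    (hH0 : H ≠ 0) (hk0 : k ≠ 0) (hH : S 4 H = -H⁻¹) (hk : S 4 k = -k⁻¹) {ε : F}
    (hε : ε = 1 ∨ ε = -1) (h : SpanEquiv (signedPsi S 4 1 H) (signedPsi S 4 ε k)) :
    (H = k ∨ H = -k) ∨ (H = k⁻¹ ∨ H = -k⁻¹) := by
  have hfix : ∀ u, S (4 - 2) u = u → S 4 u = u := by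
    intro u hu
    rw [← hS.comp 2 2, hu, hu]
  have hSε : ∀ i, S i ε = ε := by
    intro i
    rcases hε with rfl | rfl <;> simp
  obtain ⟨M, hM, h1, h2⟩ := h
  obtain ⟨α, β, rfl⟩ := Submodule.mem_span_pair.1 h1
  obtain ⟨γ, δ, h2⟩ := Submodule.mem_span_pair.1 h2
  have hc := hS.coeff_eq_zero (m := 8) (fun i => i) (by decide)
    ![-(ε * S 1 β * S 1 k * S 4 k) + ε * S 3 β * S 3 k * S 4 k + H * S 1 H * S 5 β
        - H * S 3 H * S 7 β - γ,
      S 1 α - δ,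
      S 1 β - ε * S 3 β * S 3 k * S 6 k + ε * H * S 1 H * S 5 β * S 5 k * S 6 k
        - H * S 3 H * S 7 β,
      S 3 α - δ,
      S 1 β + S 3 β - ε * H * S 1 H * S 5 β * S 5 k * k - ε * H * S 3 H * S 7 β * S 7 k * k,
      H * S 1 H * S 5 α - δ * ε * k * S 1 k,
      S 3 β + ε * S 1 β * S 1 k * S 2 k + H * S 1 H * S 5 β
        + ε * H * S 3 H * S 7 β * S 7 k * S 2 k,
      -(H * S 3 H * S 7 α) + δ * ε * k * S 3 k] (by
    intro x
    have := congrFun h2 x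
    simp only [signedPsi, Function.comp_apply, Pi.add_apply, Pi.smul_apply, smul_eq_mul, map_add,
      map_mul, map_sub, hS.comp_mod, one_mul, Nat.reduceAdd, Nat.reduceSub, Nat.reduceMul,
      Nat.reduceMod, hS.zero, hSε] at this
    simp [Fin.sum_univ_succ, hS.zero]
    linear_combination -this)
  by_cases hβ : β = 0
  · left
    have hα : α ≠ 0 := ne_zero_of_bijective_mul (by
      convert hM using 1
      ext x
      simp [hβ])
    have c1 := hc 1
    have c3 := hc 3
    have c5 := hc 5
    have c7 := hc 7
    simp at c1 c3 c5 c7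
    have hα2 : S 2 α = α := hS.fixed_of_map_one_eq (t := 4) (by norm_num) (by
      simp only [Nat.reduceSub]
      linear_combination c1 - c3)
    rw [← hS.comp 1 4, ← hS.comp 2 2, hα2, hα2] at c5
    rw [← hS.comp 1 6, ← hS.comp 2 4, ← hS.comp 2 2, hα2, hα2, hα2] at c7
    have hα1 : S 1 α ≠ 0 := by simpa using hα
    refine eq_or_neg_eq_of_mul_eq (t := 4) (ε := ε) hS (by norm_num) hfix hH0 hk0 hH hk ?_ ?_ <;>
      apply mul_left_cancel₀ hα1
    · linear_combination c5 - ε * k * S 1 k * c1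
    · simp only [Nat.reduceSub]
      linear_combination -c7 - ε * k * S 3 k * c1
  · refine eq_or_eq_inv_of_middle_coeff (t := 4) hS (by norm_num) hfix hH0 hk0 hH hk hε hβ ?_
    have c4 := hc 4
    simp at c4
    simp only [Nat.reduceAdd, Nat.reduceSub, Nat.reduceMul]
    linear_combination c4

end

/-! ### Sufficiency: explicit changes of variable -/

section

variable {F : Type*} [Field F] {q t : ℕ} {S : ℕ → F →+* F} {k : F}

theorem signedPsi_neg (S : ℕ → F →+* F) (t : ℕ) (ε k : F) :
    signedPsi S t ε (-k) = signedPsi S t ε k := by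
  ext x
  simp [signedPsi]

theorem spanEquiv_refl (f : F → F) : SpanEquiv f f :=
  ⟨fun x => x, Function.bijective_id, Submodule.subset_span (by simp),
    Submodule.subset_span (by simp [Function.comp_def])⟩

theorem IsCyclicSystem.sq_ne_neg_one_of_two (hS : IsCyclicSystem 8 S) (h2 : (2 : F) ≠ 0)
    (hk0 : k ≠ 0) (hk : S 4 k = -k⁻¹) : S 2 k ≠ -k ∧ S 2 k ≠ k⁻¹ := by
  -- In both cases `k ^ 2 = -1`, so that `S 1 k = ± k` and `S 2 k = k`.
  have key : S 4 k = k → S 2 k = k := by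
    intro h
    rw [hk] at h
    have hsq : k ^ 2 = -1 := by
      field_simp at h
      linear_combination -h
    have h1 : S 1 k ^ 2 = k ^ 2 := by rw [← map_pow, hsq, map_neg, map_one]
    rw [← hS.comp 1 1]
    rcases sq_eq_sq_iff_eq_or_eq_neg.1 h1 with h | h
    · rw [h, h]
    · rw [h, map_neg, h, neg_neg]
  constructor
  · intro h
    have h4 : S 4 k = k := by rw [← hS.comp 2 2, h, map_neg, h, neg_neg]
    have := key h4
    rw [this] at h
    exact mul_ne_zero h2 hk0 (by linear_combination h)
  · intro h
    have h4 : S 4 k = k := by rw [← hS.comp 2 2, h, map_inv₀, h, inv_inv]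
    have h5 := key h4
    rw [h] at h5
    rw [hk, h5] at h4
    exact mul_ne_zero h2 hk0 (by linear_combination -h4)

/-- The inverse of `ψ_k` is, up to scalars, `signedPsi S 4 (-1) k`: an explicit `q`-polynomial `T`
satisfies `T ∘ ψ_k = κ x`, and `T (γ z)` is proportional to `signedPsi S 4 (-1) k z` for some `γ`
provided by Hilbert's Theorem 90. -/
theorem spanEquiv_signedPsi_neg_one [Finite F] (hS : IsCyclicSystem 8 S) (hk0 : k ≠ 0)
    (hk : S 4 k = -k⁻¹) : SpanEquiv (signedPsi S 4 1 k) (signedPsi S 4 (-1) k) := by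
  by_cases h2 : (2 : F) = 0
  · rw [show (-1 : F) = 1 by linear_combination -h2]
    exact spanEquiv_refl _
  obtain ⟨hne1, hne2⟩ := hS.sq_ne_neg_one_of_two h2 hk0 hk
  have hk5 : S 5 k = -(S 1 k)⁻¹ := hS.map_inv_of_norm (t := 4) (i := 1) hk
  have hk6 : S 6 k = -(S 2 k)⁻¹ := hS.map_inv_of_norm (t := 4) (i := 2) hk
  have hk7 : S 7 k = -(S 3 k)⁻¹ := hS.map_inv_of_norm (t := 4) (i := 3) hk
  have hk1 : S 1 k ≠ 0 := by simpa using hk0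
  have hk2 : S 2 k ≠ 0 := by simpa using hk0
  have hk3 : S 3 k ≠ 0 := by simpa using hk0
  have hd : k + S 2 k ≠ 0 := fun h => hne1 (by linear_combination h)
  have he : k * S 2 k - 1 ≠ 0 := fun h =>
    hne2 (eq_inv_of_mul_eq_one_right (by linear_combination h))
  have hd1 : S 1 k + S 3 k ≠ 0 := by
    have : S 1 (k + S 2 k) ≠ 0 := (map_ne_zero _).2 hd
    rwa [map_add, hS.comp] at this
  set m : F := (k * S 2 k - 1) / (k + S 2 k) with hm
  have hm0 : m ≠ 0 := div_ne_zero he hd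
  have hm2 : S 2 m = -m⁻¹ := by
    have h' : S 2 k + -k⁻¹ ≠ 0 := by
      intro h
      exact hne2 (by linear_combination h)
    rw [hm, map_div₀, map_sub, map_add, map_mul, hS.comp, map_one, hk, inv_div, ← neg_div,
      div_eq_div_iff h' he]
    field_simp
    ring
  set κ : F := (1 - k * S 2 k) * (S 1 k + S 3 k) / k with hκ
  have hκ0 : κ ≠ 0 := div_ne_zero (mul_ne_zero (fun h => he (by linear_combination -h)) hd1) hk0
  set T : F → F := fun z => S 1 z + S 2 k * m * S 3 z - S 1 k * S 2 k * S 5 z - S 3 k * m * S 7 z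
    with hT
  have hTf : ∀ x, T (signedPsi S 4 1 k x) = κ * x := by
    intro x
    simp only [hT, signedPsi, map_add, map_mul, map_sub, hS.comp_mod, one_mul, Nat.reduceAdd,
      Nat.reduceSub, Nat.reduceMul, Nat.reduceMod, hS.zero, hk, hk5, hk6, hk7, hm, hκ]
    field_simp
    ring
  have hleft : Function.LeftInverse (fun z => κ⁻¹ * T z) (signedPsi S 4 1 k) := fun x => by
    simp only [hTf, inv_mul_cancel_left₀ hκ0]
  have hfbij : Function.Bijective (signedPsi S 4 1 k) :=
    Finite.injective_iff_bijective.1 hleft.injective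
  have hright : Function.RightInverse (fun z => κ⁻¹ * T z) (signedPsi S 4 1 k) :=
    hleft.rightInverse_of_surjective hfbij.2
  have hgbij : Function.Bijective fun z => κ⁻¹ * T z := ⟨hright.injective, hleft.surjective⟩
  have hm4 : S 4 m = m := by rw [← hS.comp 2 2, hm2, map_neg, map_inv₀, hm2]; simp
  have hm6 : S 6 m = -m⁻¹ := by rw [← hS.comp 2 4, hm4, hm2]
  have hk8 : S 8 k = k := by rw [hS.mod, Nat.mod_self, hS.zero]
  obtain ⟨γ, hγ0, hγ⟩ := hS.exists_mul_eq_self (d := 2) (m := 4) (by norm_num) (by norm_num)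
    (S 7 (S 2 k * m)) (by
      have h1 : ∏ i ∈ Finset.range 4, S (2 * i) (S 7 (S 2 k * m))
          = S 7 (∏ i ∈ Finset.range 4, S (2 * i) (S 2 k * m)) := by
        rw [map_prod]
        exact Finset.prod_congr rfl fun i _ => by rw [hS.comp, hS.comp, add_comm]
      have h2 : ∏ i ∈ Finset.range 4, S (2 * i) (S 2 k * m) = 1 := by
        simp only [Finset.prod_range_succ, Finset.prod_range_zero, map_mul, hS.comp, Nat.reduceAdd,
          Nat.reduceMul, hS.zero, hk, hk6, hk8, hm2, hm4, hm6, one_mul]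
        field_simp
      rw [h1, h2, map_one])
  have hγ1 : S 2 k * m * S 3 γ = S 1 γ := by
    have := congrArg (S 1) hγ
    rwa [map_mul, hS.comp, hS.comp, hS.mod (1 + 7), show (1 + 7) % 8 = 0 from rfl, hS.zero] at this
  have hγ3 : S 5 γ = k * m * S 3 γ := by
    have := congrArg (S 2) hγ1
    simp only [map_mul, hS.comp, Nat.reduceAdd, hk, hm2] at this
    field_simp at this
    linear_combination this
  have hγ7 : S 7 γ = -(S 2 k / m) * S 5 γ := by
    have := congrArg (S 2) hγ3
    simp only [map_mul, hS.comp, Nat.reduceAdd, hm2] at this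
    rw [this]
    field_simp
  refine ⟨fun z => κ⁻¹ * T (γ * z), hgbij.comp (mulLeft_bijective₀ _ hγ0), ?_, ?_⟩
  · refine Submodule.mem_span_pair.2 ⟨0, κ⁻¹ * S 1 γ, ?_⟩
    ext z
    simp only [Pi.add_apply, Pi.smul_apply, smul_eq_mul, zero_mul, zero_add, hT, signedPsi, map_mul,
      Nat.reduceAdd, Nat.reduceSub, Nat.reduceMul, hγ7, hγ3, ← hγ1]
    field_simp
    ring
  · refine Submodule.mem_span_pair.2 ⟨γ, 0, ?_⟩
    ext z
    have := hright (γ * z)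
    simp only [Function.comp_apply]
    rw [this]
    simp

end

/-! ### Expressing both codes through one generator -/

section

variable {F : Type*} [Field F] {q t s l : ℕ} {S : ℕ → F →+* F} {k : F}

theorem psi_eq_signedPsi (ht : 3 ≤ t) (hS : IsCyclicSystem (2 * t) S)
    (hSx : ∀ i x, S i x = x ^ (q ^ (s * i))) (hk0 : k ≠ 0) (hk : S t k = -k⁻¹) :
    psi q t s k = signedPsi S t 1 k := by
  ext x
  have h := hS.map_inv_of_norm (i := t - 1) hk
  rw [show t + (t - 1) = 2 * t - 1 by omega] at h
  rw [psi_apply_eq hSx hk0, h, signedPsi, div_neg, div_inv_eq_mul]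
  ring

variable [Finite F]

theorem psi_apply_eq_of_modEq (hn : 0 < 2 * t) (hF : Nat.card F = q ^ (2 * t)) (hq : IsPrimePow q)
    (hl : Nat.Coprime l (2 * t)) (hS : IsCyclicSystem (2 * t) S)
    (hSx : ∀ i x, S i x = x ^ (q ^ (s * i))) (hk0 : k ≠ 0) {e : ℕ} (he : l ≡ s * e [MOD 2 * t])
    (x : F) : psi q t l k x = S (e * 1 % (2 * t)) x + S (e * (t - 1) % (2 * t)) x
      + k * S (e * 1 % (2 * t)) k * S (e * (t + 1) % (2 * t)) x
      + k / S (e * (2 * t - 1) % (2 * t)) k * S (e * (2 * t - 1) % (2 * t)) x := by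
  obtain ⟨T, -, hTx⟩ := exists_isCyclicSystem hq hn hF hl
  have hT : ∀ i x, T i x = S (e * i % (2 * t)) x := by
    intro i x
    rw [← hS.mod, hTx, hSx, pow_pow_mod_eq hF, he.mul_right i, ← pow_pow_mod_eq hF, mul_assoc]
  rw [psi_apply_eq hTx hk0]
  simp only [hT]

end

section

variable {F : Type*} [Field F] {S : ℕ → F →+* F} {k : F}

theorem exists_map_eq_neg {n d m : ℕ} (hS : IsCyclicSystem n S) (hm : 0 < m) (hme : Even m)
    (hn : n = d * m) : ∃ c, c ≠ 0 ∧ S d c = -c := by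
  obtain ⟨c, hc, h⟩ := hS.exists_mul_eq_self hm hn (-1) (by simp [hme.neg_one_pow])
  exact ⟨c, hc, by linear_combination -h⟩

/-- Replacing the generator by its inverse amounts, for `t = 3`, to passing from `k` to `k⁻¹`. -/
theorem exists_psi_inverse_generator_three (hS : IsCyclicSystem 6 S) (hk0 : k ≠ 0)
    (hk : S 3 k = -k⁻¹) : ∃ a d : F, a ≠ 0 ∧ d ≠ 0 ∧ ∀ x,
      S 5 x + S 4 x + k * S 5 k * S 2 x + k / S 1 k * S 1 x
        = d * signedPsi S 3 1 k⁻¹ (a * x) := by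
  obtain ⟨c, hc, hc1⟩ := exists_map_eq_neg hS (d := 1) (m := 6) (by norm_num) (by decide)
    (by norm_num)
  have hc2 : S 2 c = c := by rw [← hS.comp 1 1, hc1, map_neg, hc1, neg_neg]
  have hc4 : S 4 c = c := by rw [← hS.comp 2 2, hc2, hc2]
  have hc5 : S 5 c = -c := by rw [← hS.comp 1 4, hc4, hc1]
  have hk4 : S 4 k = -(S 1 k)⁻¹ := hS.map_inv_of_norm (t := 3) (i := 1) hk
  have hk5 : S 5 k = -(S 2 k)⁻¹ := hS.map_inv_of_norm (t := 3) (i := 2) hk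
  have hk1 : S 1 k ≠ 0 := by simpa using hk0
  have hk2 : S 2 k ≠ 0 := by simpa using hk0
  refine ⟨c / k, -(k / c), div_ne_zero hc hk0, neg_ne_zero.2 (div_ne_zero hk0 hc), fun x => ?_⟩
  simp only [signedPsi, map_mul, map_div₀, map_inv₀, Nat.reduceAdd, Nat.reduceSub, Nat.reduceMul,
    hc1, hc2, hc4, hc5, hk4, hk5]
  field_simp
  ring

/-- Replacing the generator `σ` by `σ ^ 5` amounts, for `t = 4`, to passing from `k` to `k⁻¹`. -/
theorem exists_psi_generator_pow_five (hS : IsCyclicSystem 8 S) (hk0 : k ≠ 0)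
    (hk : S 4 k = -k⁻¹) : ∃ a d : F, a ≠ 0 ∧ d ≠ 0 ∧ ∀ x,
      S 5 x + S 7 x + k * S 5 k * S 1 x + k / S 3 k * S 3 x
        = d * signedPsi S 4 1 k⁻¹ (a * x) := by
  obtain ⟨c, hc, hc2⟩ := exists_map_eq_neg hS (d := 2) (m := 4) (by norm_num) (by decide)
    (by norm_num)
  have hc3 : S 3 c = -S 1 c := by rw [← hS.comp 1 2, hc2, map_neg]
  have hc5 : S 5 c = S 1 c := by rw [← hS.comp 3 2, hc2, map_neg, hc3, neg_neg]
  have hc7 : S 7 c = -S 1 c := by rw [← hS.comp 5 2, hc2, map_neg, hc5]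
  have hk5 : S 5 k = -(S 1 k)⁻¹ := hS.map_inv_of_norm (t := 4) (i := 1) hk
  have hk7 : S 7 k = -(S 3 k)⁻¹ := hS.map_inv_of_norm (t := 4) (i := 3) hk
  have hk1 : S 1 k ≠ 0 := by simpa using hk0
  have hk3 : S 3 k ≠ 0 := by simpa using hk0
  have hc1 : S 1 c ≠ 0 := by simpa using hc
  refine ⟨c / k, -(k / S 1 c), div_ne_zero hc hk0, neg_ne_zero.2 (div_ne_zero hk0 hc1),
    fun x => ?_⟩
  simp only [signedPsi, map_mul, map_div₀, map_inv₀, Nat.reduceAdd, Nat.reduceSub, Nat.reduceMul,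
    hc3, hc5, hc7, hk5, hk7]
  field_simp
  ring

/-- Replacing the generator `σ` by `σ ^ 7` amounts, for `t = 4`, to passing from `k` to `k⁻¹` and
changing the sign. -/
theorem exists_psi_generator_pow_seven (hS : IsCyclicSystem 8 S) (hk0 : k ≠ 0)
    (hk : S 4 k = -k⁻¹) : ∃ a d : F, a ≠ 0 ∧ d ≠ 0 ∧ ∀ x,
      S 7 x + S 5 x + k * S 7 k * S 3 x + k / S 1 k * S 1 x
        = d * signedPsi S 4 (-1) k⁻¹ (a * x) := by
  obtain ⟨c, hc, hc2⟩ := exists_map_eq_neg hS (d := 2) (m := 4) (by norm_num) (by decide)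
    (by norm_num)
  have hc3 : S 3 c = -S 1 c := by rw [← hS.comp 1 2, hc2, map_neg]
  have hc5 : S 5 c = S 1 c := by rw [← hS.comp 3 2, hc2, map_neg, hc3, neg_neg]
  have hc7 : S 7 c = -S 1 c := by rw [← hS.comp 5 2, hc2, map_neg, hc5]
  have hk5 : S 5 k = -(S 1 k)⁻¹ := hS.map_inv_of_norm (t := 4) (i := 1) hk
  have hk7 : S 7 k = -(S 3 k)⁻¹ := hS.map_inv_of_norm (t := 4) (i := 3) hk
  have hk1 : S 1 k ≠ 0 := by simpa using hk0
  have hk3 : S 3 k ≠ 0 := by simpa using hk0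
  have hc1 : S 1 c ≠ 0 := by simpa using hc
  refine ⟨c / k, k / S 1 c, div_ne_zero hc hk0, div_ne_zero hk0 hc1, fun x => ?_⟩
  simp only [signedPsi, map_mul, map_div₀, map_inv₀, Nat.reduceAdd, Nat.reduceSub, Nat.reduceMul,
    hc3, hc5, hc7, hk5, hk7]
  field_simp
  ring

end

/-! ### The classification -/

/-- The class of `k` up to sign and field automorphisms is stable under inversion, because
`k ^ (q ^ t) = -k⁻¹`. -/
theorem exists_ringEquiv_eq_inv_iff {F : Type*} [Field F] (R : F ≃+* F) {h k : F}
    (hR : R k = -k⁻¹) :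
    (∃ ρ : F ≃+* F, ρ h = k⁻¹ ∨ ρ h = -k⁻¹) ↔ ∃ ρ : F ≃+* F, ρ h = k ∨ ρ h = -k := by
  constructor
  · rintro ⟨ρ, hρ | hρ⟩
    · exact ⟨ρ.trans R, Or.inr (by simp [hρ, hR])⟩
    · exact ⟨ρ.trans R, Or.inl (by simp [hρ, hR])⟩
  · rintro ⟨ρ, hρ | hρ⟩
    · exact ⟨ρ.trans R, Or.inr (by simp [hρ, hR])⟩
    · exact ⟨ρ.trans R, Or.inl (by simp [hρ, hR])⟩

theorem mod_two_eq_one_of_coprime {s t : ℕ} (hs : Nat.Coprime s (2 * t)) : s % 2 = 1 :=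
  Nat.odd_iff.1 (Nat.coprime_two_right.1 (hs.coprime_dvd_right (Dvd.intro _ rfl)))

theorem mod_six_of_coprime {s : ℕ} (hs : Nat.Coprime s (2 * 3)) : s % 6 = 1 ∨ s % 6 = 5 := by
  have h2 := mod_two_eq_one_of_coprime hs
  have h3 : s % 3 ≠ 0 := fun h =>
    absurd (Nat.eq_one_of_dvd_coprimes hs (Nat.dvd_of_mod_eq_zero h) (by norm_num)) (by norm_num)
  omega

theorem mod_eight_of_coprime {s : ℕ} (hs : Nat.Coprime s (2 * 4)) :
    s % 8 = 1 ∨ s % 8 = 3 ∨ s % 8 = 5 ∨ s % 8 = 7 := by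
  have h2 := mod_two_eq_one_of_coprime hs
  omega

section

variable {F : Type*} [Field F] [Finite F] {q t s l : ℕ} {h k : F}

/-- Combines the reduction to `SpanEquiv` with a description `ψ_{k,l}(x) = d g(a x)`,
`g = signedPsi S t ε k'`, of the second code in terms of the generator that defines the first. -/
theorem codeEquiv_iff_of_spanEquiv (hq : IsPrimePow q) (ht : 3 ≤ t)
    (hF : Nat.card F = q ^ (2 * t)) (hh0 : h ≠ 0) (hk0 : k ≠ 0) (hs : Nat.Coprime s (2 * t))
    (hl : Nat.Coprime l (2 * t)) {S : ℕ → F →+* F} (hS : IsCyclicSystem (2 * t) S)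
    (hSx : ∀ i x, S i x = x ^ (q ^ (s * i))) (hh : S t h = -h⁻¹) (hk : S t k = -k⁻¹)
    {ε k' a d : F} (ha : a ≠ 0) (hd : d ≠ 0)
    (hg : ∀ x, psi q t l k x = d * signedPsi S t ε k' (a * x)) (hk' : k' = k ∨ k' = k⁻¹)
    (hnec : ∀ H, H ≠ 0 → S t H = -H⁻¹ → SpanEquiv (signedPsi S t 1 H) (signedPsi S t ε k') →
      (H = k' ∨ H = -k') ∨ (H = k'⁻¹ ∨ H = -k'⁻¹))
    (hsuf : SpanEquiv (signedPsi S t 1 k') (signedPsi S t ε k')) :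
    CodeEquiv q (2 * t) (codeC q t s h : Set (F → F)) (codeC q t l k : Set (F → F)) ↔
      ∃ ρ : F ≃+* F, ρ h = k ∨ ρ h = -k := by
  have hρS : ∀ (ρ : F ≃+* F), S t (ρ h) = -(ρ h)⁻¹ := by
    intro ρ
    rw [hSx, ← map_pow, ← hSx, hh, map_neg, map_inv₀]
  have hρ0 : ∀ (ρ : F ≃+* F), ρ h ≠ 0 := fun ρ => by simpa using hh0
  have hinv := exists_ringEquiv_eq_inv_iff (h := h) (k := k)
    (RingEquiv.ofBijective (S t) (Finite.injective_iff_bijective.1 (S t).injective)) hk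
  have hequiv : ∀ ρ : F ≃+* F, SpanEquiv (psi q t s (ρ h)) (psi q t l k) ↔
      SpanEquiv (signedPsi S t 1 (ρ h)) (signedPsi S t ε k') := by
    intro ρ
    rw [spanEquiv_comp_mul_iff ha hd hg, psi_eq_signedPsi ht hS hSx (hρ0 ρ) (hρS ρ)]
  rw [codeEquiv_codeC_iff hq ht hF hh0 hk0 hs hl]
  constructor
  · rintro ⟨ρ, hρ⟩
    have := hnec _ (hρ0 ρ) (hρS ρ) ((hequiv ρ).1 hρ)
    rcases hk' with rfl | rfl
    · rcases this with h1 | h1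
      · exact ⟨ρ, h1⟩
      · exact hinv.1 ⟨ρ, h1⟩
    · rw [inv_inv] at this
      rcases this with h1 | h1
      · exact hinv.1 ⟨ρ, h1⟩
      · exact ⟨ρ, h1⟩
  · intro hρ
    have hρ' : ∃ ρ : F ≃+* F, ρ h = k' ∨ ρ h = -k' := by
      rcases hk' with rfl | rfl
      · exact hρ
      · exact hinv.2 hρ
    obtain ⟨ρ, hρ⟩ := hρ'
    refine ⟨ρ, (hequiv ρ).2 ?_⟩
    rcases hρ with hρ | hρ
    · rwa [hρ]
    · rwa [hρ, signedPsi_neg]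

theorem map_eq_neg_inv_of_pow_eq (hF : Nat.card F = q ^ (2 * t))
    (hs : Nat.Coprime s (2 * t)) {S : ℕ → F →+* F} (hSx : ∀ i x, S i x = x ^ (q ^ (s * i)))
    (hk : k ^ (q ^ t + 1) = -1) : S t k = -k⁻¹ := by
  have hk0 : k ≠ 0 := by
    rintro rfl
    simp at hk
  have hodd : Odd s := Nat.odd_iff.2 (mod_two_eq_one_of_coprime hs)
  -- `s` is odd, so the `t`-th power of the generator is the involution `x ↦ x ^ (q ^ t)`.
  have hst : s * t % (2 * t) = t % (2 * t) := by
    obtain ⟨r, rfl⟩ := hodd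
    rw [show (2 * r + 1) * t = t + 2 * t * r by ring, Nat.add_mul_mod_self_left]
  rw [hSx, pow_pow_mod_eq hF, hst, ← pow_pow_mod_eq hF]
  rw [← inv_neg, ← mul_eq_one_iff_eq_inv₀ (neg_ne_zero.2 hk0), mul_neg, ← pow_succ, hk, neg_neg]

theorem codeEquiv_three_iff (hq : IsPrimePow q) (hF : Nat.card F = q ^ (2 * 3))
    (hh : h ^ (q ^ 3 + 1) = -1) (hk : k ^ (q ^ 3 + 1) = -1) (hs : Nat.Coprime s (2 * 3))
    (hl : Nat.Coprime l (2 * 3)) :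
    CodeEquiv q (2 * 3) (codeC q 3 s h : Set (F → F)) (codeC q 3 l k : Set (F → F)) ↔
      ∃ ρ : F ≃+* F, ρ h = k ∨ ρ h = -k := by
  obtain ⟨S, hS, hSx⟩ := exists_isCyclicSystem hq (by norm_num) hF hs
  have hh0 : h ≠ 0 := by rintro rfl; simp at hh
  have hk0 : k ≠ 0 := by rintro rfl; simp at hk
  have hh3 : S 3 h = -h⁻¹ := map_eq_neg_inv_of_pow_eq hF hs hSx hh
  have hk3 : S 3 k = -k⁻¹ := map_eq_neg_inv_of_pow_eq hF hs hSx hk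
  have hk3' : S 3 k⁻¹ = -k⁻¹⁻¹ := by rw [map_inv₀, hk3, inv_neg]
  have he : l ≡ s * 1 [MOD 6] ∨ l ≡ s * 5 [MOD 6] := by
    simp only [Nat.ModEq]
    rcases mod_six_of_coprime hs with h1 | h1 <;> rcases mod_six_of_coprime hl with h2 | h2 <;> omega
  rcases he with he | he
  · refine codeEquiv_iff_of_spanEquiv hq le_rfl hF hh0 hk0 hs hl hS hSx hh3 hk3
      (ε := 1) (k' := k) (a := 1) (d := 1) one_ne_zero one_ne_zero ?_ (Or.inl rfl)
      (fun H hH0 hH => SpanEquiv.eq_or_eq_inv_three hS hH0 hk0 hH hk3) (spanEquiv_refl _)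
    intro x
    rw [one_mul, one_mul, ← psi_eq_signedPsi le_rfl hS hSx hk0 hk3,
      psi_apply_eq_of_modEq (by norm_num) hF hq hl hS hSx hk0 he, psi_apply_eq hSx hk0]
  · obtain ⟨a, d, ha, hd, had⟩ := exists_psi_inverse_generator_three hS hk0 hk3
    refine codeEquiv_iff_of_spanEquiv hq le_rfl hF hh0 hk0 hs hl hS hSx hh3 hk3
      (ε := 1) (k' := k⁻¹) ha hd ?_ (Or.inr rfl)
      (fun H hH0 hH => SpanEquiv.eq_or_eq_inv_three hS hH0 (inv_ne_zero hk0) hH hk3')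
      (spanEquiv_refl _)
    intro x
    rw [← had, psi_apply_eq_of_modEq (by norm_num) hF hq hl hS hSx hk0 he]

theorem codeEquiv_four_iff (hq : IsPrimePow q) (hF : Nat.card F = q ^ (2 * 4))
    (hh : h ^ (q ^ 4 + 1) = -1) (hk : k ^ (q ^ 4 + 1) = -1) (hs : Nat.Coprime s (2 * 4))
    (hl : Nat.Coprime l (2 * 4)) :
    CodeEquiv q (2 * 4) (codeC q 4 s h : Set (F → F)) (codeC q 4 l k : Set (F → F)) ↔
      ∃ ρ : F ≃+* F, ρ h = k ∨ ρ h = -k := by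
  obtain ⟨S, hS, hSx⟩ := exists_isCyclicSystem hq (by norm_num) hF hs
  have hh0 : h ≠ 0 := by rintro rfl; simp at hh
  have hk0 : k ≠ 0 := by rintro rfl; simp at hk
  have hk0' : k⁻¹ ≠ 0 := inv_ne_zero hk0
  have hh4 : S 4 h = -h⁻¹ := map_eq_neg_inv_of_pow_eq hF hs hSx hh
  have hk4 : S 4 k = -k⁻¹ := map_eq_neg_inv_of_pow_eq hF hs hSx hk
  have hk4' : S 4 k⁻¹ = -k⁻¹⁻¹ := by rw [map_inv₀, hk4, inv_neg]
  have he : l ≡ s * 1 [MOD 8] ∨ l ≡ s * 3 [MOD 8] ∨ l ≡ s * 5 [MOD 8] ∨ l ≡ s * 7 [MOD 8] := by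
    simp only [Nat.ModEq]
    rcases mod_eight_of_coprime hs with h1 | h1 | h1 | h1 <;>
      rcases mod_eight_of_coprime hl with h2 | h2 | h2 | h2 <;> omega
  have hpsi := fun e he => psi_apply_eq_of_modEq (e := e) (by norm_num) hF hq hl hS hSx hk0 he
  rcases he with he | he | he | he
  · refine codeEquiv_iff_of_spanEquiv hq (by norm_num) hF hh0 hk0 hs hl hS hSx hh4 hk4
      (ε := 1) (k' := k) (a := 1) (d := 1) one_ne_zero one_ne_zero ?_ (Or.inl rfl)
      (fun H hH0 hH => SpanEquiv.eq_or_eq_inv_four hS hH0 hk0 hH hk4 (Or.inl rfl))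
      (spanEquiv_refl _)
    intro x
    rw [one_mul, one_mul, ← psi_eq_signedPsi (by norm_num) hS hSx hk0 hk4, hpsi _ he,
      psi_apply_eq hSx hk0]
  · refine codeEquiv_iff_of_spanEquiv hq (by norm_num) hF hh0 hk0 hs hl hS hSx hh4 hk4
      (ε := -1) (k' := k) (a := 1) (d := 1) one_ne_zero one_ne_zero ?_ (Or.inl rfl)
      (fun H hH0 hH => SpanEquiv.eq_or_eq_inv_four hS hH0 hk0 hH hk4 (Or.inr rfl))
      (spanEquiv_signedPsi_neg_one hS hk0 hk4)
    intro x
    have hk5 : S 5 k = -(S 1 k)⁻¹ := hS.map_inv_of_norm (t := 4) (i := 1) hk4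
    rw [one_mul, one_mul, hpsi _ he, signedPsi]
    simp only [Nat.reduceAdd, Nat.reduceSub, Nat.reduceMul, Nat.reduceMod, hk5, div_neg,
      div_inv_eq_mul]
    ring
  · obtain ⟨a, d, ha, hd, had⟩ := exists_psi_generator_pow_five hS hk0 hk4
    refine codeEquiv_iff_of_spanEquiv hq (by norm_num) hF hh0 hk0 hs hl hS hSx hh4 hk4
      (ε := 1) (k' := k⁻¹) ha hd ?_ (Or.inr rfl)
      (fun H hH0 hH => SpanEquiv.eq_or_eq_inv_four hS hH0 hk0' hH hk4' (Or.inl rfl))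
      (spanEquiv_refl _)
    intro x
    rw [← had, hpsi _ he]
  · obtain ⟨a, d, ha, hd, had⟩ := exists_psi_generator_pow_seven hS hk0 hk4
    refine codeEquiv_iff_of_spanEquiv hq (by norm_num) hF hh0 hk0 hs hl hS hSx hh4 hk4
      (ε := -1) (k' := k⁻¹) ha hd ?_ (Or.inr rfl)
      (fun H hH0 hH => SpanEquiv.eq_or_eq_inv_four hS hH0 hk0' hH hk4' (Or.inr rfl))
      (spanEquiv_signedPsi_neg_one hS hk0' hk4')
    intro x
    rw [← had, hpsi _ he]

end

theorem mainTheorem1 (q t : ℕ) (hq : IsPrimePow q) (F : Type*) [Field F] [Finite F]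
    (hF : Nat.card F = q ^ (2 * t)) (h k : F)
    (hh : h ^ (q ^ t + 1) = -1) (hk : k ^ (q ^ t + 1) = -1)
    (s l : ℕ) (hs : Nat.Coprime s (2 * t)) (hl : Nat.Coprime l (2 * t)) :
    (t = 3 →
      (CodeEquiv q (2 * t) (codeC q t s h : Set (F → F)) (codeC q t l k : Set (F → F)) ↔
        ((s : ℤ) ≡ l [ZMOD 6] ∧ ∃ ρ : F ≃+* F, ρ h = k ∨ ρ h = -k) ∨
        ((s : ℤ) ≡ -l [ZMOD 6] ∧ ∃ ρ : F ≃+* F, ρ h = k⁻¹ ∨ ρ h = -k⁻¹))) ∧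
    (t = 4 →
      (CodeEquiv q (2 * t) (codeC q t s h : Set (F → F)) (codeC q t l k : Set (F → F)) ↔
        ((s : ℤ) ≡ l [ZMOD 8] ∧ ∃ ρ : F ≃+* F, ρ h = k ∨ ρ h = -k) ∨
        ((s : ℤ) ≡ -l [ZMOD 8] ∧ ∃ ρ : F ≃+* F, ρ h = k⁻¹ ∨ ρ h = -k⁻¹) ∨
        ((s : ℤ) ≡ 3 * l [ZMOD 8] ∧ ∃ ρ : F ≃+* F, ρ h = k ∨ ρ h = -k) ∨
        ((s : ℤ) ≡ 5 * l [ZMOD 8] ∧ ∃ ρ : F ≃+* F, ρ h = k⁻¹ ∨ ρ h = -k⁻¹))) := by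
  have hk0 : k ≠ 0 := by rintro rfl; simp at hk
  have hn : 0 < 2 * t := Nat.pos_of_ne_zero fun h0 => by
    have := Finite.one_lt_card (α := F)
    rw [hF, h0, pow_zero] at this
    exact lt_irrefl _ this
  obtain ⟨S, -, hSx⟩ := exists_isCyclicSystem hq hn hF (Nat.coprime_one_left _)
  have hinv := exists_ringEquiv_eq_inv_iff (h := h) (k := k)
    (RingEquiv.ofBijective (S t) (Finite.injective_iff_bijective.1 (S t).injective))
    (map_eq_neg_inv_of_pow_eq hF (Nat.coprime_one_left _) hSx hk)
  -- The congruences exhaust the residues coprime to `2 t`, and both conditions on `h`, `k` agree.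
  refine ⟨?_, ?_⟩
  · rintro rfl
    rw [codeEquiv_three_iff hq hF hh hk hs hl, hinv]
    have hsl : (s : ℤ) ≡ l [ZMOD 6] ∨ (s : ℤ) ≡ -l [ZMOD 6] := by
      simp only [Int.ModEq]
      rcases mod_six_of_coprime hs with h1 | h1 <;> rcases mod_six_of_coprime hl with h2 | h2 <;> omega
    simp only [← or_and_right]
    rw [and_iff_right hsl]
  · rintro rfl
    rw [codeEquiv_four_iff hq hF hh hk hs hl, hinv]
    have hsl : (s : ℤ) ≡ l [ZMOD 8] ∨ (s : ℤ) ≡ -l [ZMOD 8] ∨ (s : ℤ) ≡ 3 * l [ZMOD 8] ∨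
        (s : ℤ) ≡ 5 * l [ZMOD 8] := by
      simp only [Int.ModEq]
      rcases mod_eight_of_coprime hs with h1 | h1 | h1 | h1 <;>
        rcases mod_eight_of_coprime hl with h2 | h2 | h2 | h2 <;> omega
    simp only [← or_and_right]
    rw [and_iff_right hsl]
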